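/- For $\epsilon,\epsilon'\in\mathbb{R}$, $\zeta\in\mathbb{C}$ and $\tau\in\mathbb{C}$ with $\operatorname{Im}\tau>0$, let $$\theta\!\left[\begin{array}{c}\epsilon\\ \epsilon'\end{array}\right](\zeta,\tau)=\sum_{n\in\mathbb{Z}}\exp\left(2\pi i\left[\tfrac12\left(n+\tfrac{\epsilon}{2}\right)^2\tau+\left(n+\tfrac{\epsilon}{2}\right)\left(\zeta+\tfrac{\epsilon'}{2}\right)\right]\right),$$ and write $\theta[\epsilon;\epsilon']=\theta\!\left[\begin{array}{c}\epsilon\\ \epsilon'\end{array}\right](0,\tau)$ and $\theta^2[\epsilon;\epsilon']=(\theta[\epsilon;\epsilon'])^2$. Let $\zeta_3=e^{2\pi i/3}$. Then, for every $\tau$ with $\operatorname{Im}\tau>0$, the following four identities hold: (1) $\theta^2[\tfrac13;\tfrac13]\,\theta^2[\tfrac13;\tfrac43]+\zeta_3^2\,\theta^2[\tfrac23;\tfrac23]\,\theta^2[\tfrac23;\tfrac53]-\theta^2[0;0]\,\theta[0;1]\,\theta[\tfrac23;\tfrac53]=0$; (2) $\theta^2[\tfrac13;0]\,\theta^2[\tfrac13;1]+\zeta_3\,\theta^2[\tfrac23;0]\,\theta^2[\tfrac23;1]-\theta^2[0;0]\,\theta[0;1]\,\theta[\tfrac23;1]=0$;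 (3) $\theta^2[\tfrac13;\tfrac23]\,\theta^2[\tfrac13;\tfrac53]+\zeta_3^2\,\theta^2[\tfrac23;\tfrac13]\,\theta^2[\tfrac23;\tfrac43]-\zeta_3\,\theta^2[0;0]\,\theta[0;1]\,\theta[\tfrac23;\tfrac13]=0$; (4) $\theta^2[1;\tfrac13]\,\theta^2[0;\tfrac23]-\theta^2[0;\tfrac13]\,\theta^2[1;\tfrac23]-\theta^2[0;1]\,\theta[1;0]\,\theta[1;\tfrac23]=0$. -/

import Mathlib

noncomputable section

/-- The theta function with characteristics `ε, ε'` (Farkas–Kra normalisation). The series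
converges absolutely for every `τ` in the upper half plane. -/
def thetaChar (ε ε' : ℝ) (ζ : ℂ) (τ : UpperHalfPlane) : ℂ :=
  ∑' n : ℤ, Complex.exp (2 * Real.pi * Complex.I *
    ((1 / 2) * ((n : ℂ) + (ε : ℂ) / 2) ^ 2 * (τ : ℂ)
      + ((n : ℂ) + (ε : ℂ) / 2) * (ζ + (ε' : ℂ) / 2)))

/-- The theta constant with characteristics `ε, ε'`. -/
def thetaConst (ε ε' : ℝ) (τ : UpperHalfPlane) : ℂ :=
  thetaChar ε ε' 0 τ

/-- The primitive `k`-th root of unity `exp (2 π i / k)`, for `k` a positive integer. -/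
def zetaRoot (k : ℕ) : ℂ :=
  Complex.exp (2 * Real.pi * Complex.I / (k : ℂ))

end

open Complex

/-! Splitting a double series by the parity of `m + n` turns a product of two theta constants at `τ`
into a bilinear form in theta constants at `2τ`. Put `A = θ[0;0]`, `B = θ[1;0]`, `X = θ[a;2b]`, `Y =
θ[a+1;2b]`, all at `2τ`. Then `θ²[a;b] = XA + YB` and `θ²[a;b+1] = e^{πia}(XA - YB)`; raising `a` by
1 swaps `X, Y` and flips the sign of the factor. Hence both sides of `thetaConst_duplication` equal
`e^{πia}(X² - Y²)(A² + B²)`. Taking `a = 1/3` and reflecting `4/3` to `2/3` gives (1)-(3); (4) is a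
separate computation at `2τ`. -/

/-- The general term of the series defining `thetaConst ε ε' τ`. -/
noncomputable def thetaConstTerm (ε ε' : ℝ) (τ : UpperHalfPlane) (n : ℤ) : ℂ :=
  cexp (Real.pi * I * (((n : ℂ) + ε / 2) ^ 2 * τ + ((n : ℂ) + ε / 2) * ε'))

theorem thetaConst_eq_tsum (ε ε' : ℝ) (τ : UpperHalfPlane) :
    thetaConst ε ε' τ = ∑' n : ℤ, thetaConstTerm ε ε' τ n := by
  unfold thetaConst thetaChar thetaConstTerm
  refine tsum_congr fun n => congrArg cexp ?_
  ring

theorem summable_thetaConstTerm (ε ε' : ℝ) (τ : UpperHalfPlane) :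
    Summable (thetaConstTerm ε ε' τ) := by
  -- Expanding the square leaves a constant factor times a Jacobi theta series.
  have h := ((summable_jacobiTheta₂_term_iff ((ε' : ℂ) / 2 + ε * τ / 2) (τ : ℂ)).2
    τ.im_pos).mul_left (cexp (Real.pi * I * ((ε / 2) ^ 2 * τ + ε / 2 * ε')))
  refine h.congr fun n => ?_
  rw [thetaConstTerm, jacobiTheta₂_term, ← Complex.exp_add]
  congr 1
  ring

theorem thetaConst_add_two_left (ε ε' : ℝ) (τ : UpperHalfPlane) :
    thetaConst (ε + 2) ε' τ = thetaConst ε ε' τ := by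
  rw [thetaConst_eq_tsum, thetaConst_eq_tsum, ← (Equiv.subRight (1 : ℤ)).tsum_eq]
  refine tsum_congr fun n => ?_
  simp only [thetaConstTerm, Equiv.subRight_apply]
  push_cast
  congr 1
  ring

theorem thetaConst_neg_neg (ε ε' : ℝ) (τ : UpperHalfPlane) :
    thetaConst (-ε) (-ε') τ = thetaConst ε ε' τ := by
  rw [thetaConst_eq_tsum, thetaConst_eq_tsum, ← (Equiv.neg ℤ).tsum_eq]
  refine tsum_congr fun n => ?_
  simp only [thetaConstTerm, Equiv.neg_apply]
  push_cast
  congr 1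
  ring

theorem thetaConst_add_two_right (ε ε' : ℝ) (τ : UpperHalfPlane) :
    thetaConst ε (ε' + 2) τ = cexp (Real.pi * I * ε) * thetaConst ε ε' τ := by
  rw [thetaConst_eq_tsum, thetaConst_eq_tsum, ← tsum_mul_left]
  refine tsum_congr fun n => ?_
  rw [thetaConstTerm, thetaConstTerm, ← Complex.exp_add, Complex.exp_eq_exp_iff_exists_int]
  refine ⟨n, ?_⟩
  push_cast
  ring

/-- Pairs of integers `(m, n)` correspond to `(k + l, k - l)` or `(k + l + 1, k - l)` according to
the parity of `m + n`. -/
noncomputable def intProdParityEquiv : (ℤ × ℤ) ⊕ (ℤ × ℤ) ≃ ℤ × ℤ :=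
  Equiv.ofBijective
    (Sum.elim (fun p => (p.1 + p.2, p.1 - p.2)) (fun p => (p.1 + p.2 + 1, p.1 - p.2))) <| by
    constructor
    · rintro (⟨a, b⟩ | ⟨a, b⟩) (⟨c, d⟩ | ⟨c, d⟩) h <;>
        simp only [Sum.elim_inl, Sum.elim_inr, Prod.mk.injEq] at h <;>
        simp only [Sum.inl.injEq, Sum.inr.injEq, Prod.mk.injEq, reduceCtorEq] <;> omega
    · rintro ⟨m, n⟩
      rcases Int.even_or_odd' (m + n) with ⟨k, hk | hk⟩
      · exact ⟨Sum.inl (k, k - n), by simp only [Sum.elim_inl, Prod.mk.injEq]; omega⟩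
      · exact ⟨Sum.inr (k, k - n), by simp only [Sum.elim_inr, Prod.mk.injEq]; omega⟩

/-- Product formula expressing products of theta constants at `τ` by theta constants at `2 τ`. -/
theorem thetaConst_mul {τ σ : UpperHalfPlane} (hσ : (σ : ℂ) = 2 * τ) {a a' b b' p q r s : ℝ}
    (hp : a + a' = 2 * p) (hq : a - a' = 2 * q) (hr : b + b' = r) (hs : b - b' = s) :
    thetaConst a b τ * thetaConst a' b' τ =
      thetaConst p r σ * thetaConst q s σ + thetaConst (p + 1) r σ * thetaConst (q + 1) s σ := by
  obtain rfl : a = p + q := by linarith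
  obtain rfl : a' = p - q := by linarith
  subst hr hs
  have hmul (x y z w : ℝ) (ρ : UpperHalfPlane) :=
    tsum_mul_tsum_of_summable_norm (summable_thetaConstTerm x y ρ).norm
      (summable_thetaConstTerm z w ρ).norm
  have hsum (x y z w : ℝ) (ρ : UpperHalfPlane) :=
    summable_mul_of_summable_norm (summable_thetaConstTerm x y ρ).norm
      (summable_thetaConstTerm z w ρ).norm
  -- With `u = k.1 + p/2` and `v = k.2 + q/2`, this is `(u+v)² + (u-v)² = 2u² + 2v²`.
  have h₁ (k : ℤ × ℤ) : thetaConstTerm (p + q) b τ (k.1 + k.2) *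
      thetaConstTerm (p - q) b' τ (k.1 - k.2) =
      thetaConstTerm p (b + b') σ k.1 * thetaConstTerm q (b - b') σ k.2 := by
    simp only [thetaConstTerm, ← Complex.exp_add, hσ]
    push_cast
    congr 1
    ring
  -- The indices are `(k.1 + 1/2) ± (k.2 + 1/2)`, so both `p` and `q` rise by 1.
  have h₂ (k : ℤ × ℤ) : thetaConstTerm (p + q) b τ (k.1 + k.2 + 1) *
      thetaConstTerm (p - q) b' τ (k.1 - k.2) =
      thetaConstTerm (p + 1) (b + b') σ k.1 * thetaConstTerm (q + 1) (b - b') σ k.2 := by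
    simp only [thetaConstTerm, ← Complex.exp_add, hσ]
    push_cast
    congr 1
    ring
  simp only [thetaConst_eq_tsum, hmul]
  rw [← intProdParityEquiv.tsum_eq, Summable.tsum_sum]
  · exact congrArg₂ (· + ·) (tsum_congr h₁) (tsum_congr h₂)
  · exact (hsum p (b + b') q (b - b') σ).congr fun k => (h₁ k).symm
  · exact (hsum (p + 1) (b + b') (q + 1) (b - b') σ).congr fun k => (h₂ k).symm

theorem exists_coe_eq_two_mul (τ : UpperHalfPlane) : ∃ σ : UpperHalfPlane, (σ : ℂ) = 2 * τ :=
  ⟨⟨2 * τ, by simpa using τ.im_pos⟩, rfl⟩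

theorem thetaConst_sq {τ σ : UpperHalfPlane} (hσ : (σ : ℂ) = 2 * τ) (a b : ℝ) :
    thetaConst a b τ ^ 2 = thetaConst a (2 * b) σ * thetaConst 0 0 σ +
      thetaConst (a + 1) (2 * b) σ * thetaConst 1 0 σ := by
  rw [sq, thetaConst_mul hσ (p := a) (q := 0) (r := 2 * b) (s := 0) (by ring) (by ring) (by ring)
    (by ring), zero_add]

theorem exp_pi_mul_I_mul_add_one (a : ℝ) :
    cexp (Real.pi * I * (a + 1 : ℝ)) = -cexp (Real.pi * I * a) := by
  push_cast
  rw [mul_add, Complex.exp_add, mul_one, Complex.exp_pi_mul_I]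
  ring

theorem thetaConst_sq_add_one {τ σ : UpperHalfPlane} (hσ : (σ : ℂ) = 2 * τ) (a b : ℝ) :
    thetaConst a (b + 1) τ ^ 2 = cexp (Real.pi * I * a) *
      (thetaConst a (2 * b) σ * thetaConst 0 0 σ -
        thetaConst (a + 1) (2 * b) σ * thetaConst 1 0 σ) := by
  rw [thetaConst_sq hσ, show 2 * (b + 1) = 2 * b + 2 by ring, thetaConst_add_two_right,
    thetaConst_add_two_right, exp_pi_mul_I_mul_add_one]
  ring

/-- Duplication formula for theta constants. -/
theorem thetaConst_duplication (a b : ℝ) (τ : UpperHalfPlane) :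
    thetaConst a b τ ^ 2 * thetaConst a (b + 1) τ ^ 2 +
        thetaConst (a + 1) b τ ^ 2 * thetaConst (a + 1) (b + 1) τ ^ 2 =
      thetaConst 0 0 τ ^ 2 * thetaConst 0 1 τ * thetaConst (2 * a) (2 * b + 1) τ := by
  obtain ⟨σ, hσ⟩ := exists_coe_eq_two_mul τ
  have h := thetaConst_mul hσ (a := 2 * a) (b := 2 * b + 1) (a' := 0) (b' := 1) (p := a) (q := a)
    (r := 2 * b + 2) (s := 2 * b) (by ring) (by ring) (by ring) (by ring)
  rw [thetaConst_add_two_right, thetaConst_add_two_right, exp_pi_mul_I_mul_add_one] at h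
  rw [mul_assoc, mul_comm (thetaConst 0 1 τ), h, thetaConst_sq_add_one hσ, thetaConst_sq_add_one hσ,
    thetaConst_sq hσ, thetaConst_sq hσ, thetaConst_sq hσ, exp_pi_mul_I_mul_add_one,
    show a + 1 + 1 = a + 2 by ring, thetaConst_add_two_left, mul_zero, zero_add]
  ring

theorem zetaRoot_three_pow_three : zetaRoot 3 ^ 3 = 1 := by
  rw [zetaRoot, ← Complex.exp_nat_mul, Complex.exp_eq_one_iff]
  exact ⟨1, by push_cast; ring⟩

theorem exp_pi_mul_I_mul_two_thirds : cexp (Real.pi * I * (2 / 3 : ℝ)) = zetaRoot 3 := by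
  rw [zetaRoot]
  congr 1
  push_cast
  ring

/-- Reflection of the characteristic `4/3` into `2/3`. -/
theorem thetaConst_four_thirds_sq (b : ℝ) (τ : UpperHalfPlane) :
    thetaConst (4 / 3) b τ ^ 2 = zetaRoot 3 * thetaConst (2 / 3) (2 - b) τ ^ 2 := by
  have h := thetaConst_add_two_right (2 / 3) (-b) τ
  rw [exp_pi_mul_I_mul_two_thirds, neg_add_eq_sub] at h
  rw [show (4 / 3 : ℝ) = -(2 / 3) + 2 by norm_num, thetaConst_add_two_left,
    ← thetaConst_neg_neg, neg_neg, h, mul_pow]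
  -- Squaring `h` contributes `ζ₃²`, which the prefactor `ζ₃` cancels.
  linear_combination (-thetaConst (2 / 3) (-b) τ ^ 2) * zetaRoot_three_pow_three

/-- With `P = θ[0;2/3]` and `Q = θ[1;2/3]` at `2τ`, both sides equal `2PQ(A² - B²)`. -/
theorem thetaConst_one_sq_mul_sub (τ : UpperHalfPlane) :
    thetaConst 1 (1 / 3) τ ^ 2 * thetaConst 0 (2 / 3) τ ^ 2 -
        thetaConst 0 (1 / 3) τ ^ 2 * thetaConst 1 (2 / 3) τ ^ 2 =
      thetaConst 0 1 τ ^ 2 * thetaConst 1 0 τ * thetaConst 1 (2 / 3) τ := by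
  obtain ⟨σ, hσ⟩ := exists_coe_eq_two_mul τ
  have h := thetaConst_mul hσ (a := 1) (b := 2 / 3) (a' := 1) (b' := 0) (p := 1) (q := 0)
    (r := 2 / 3) (s := 2 / 3) (by ring) (by ring) (by ring) (by ring)
  have h01 := thetaConst_sq_add_one hσ 0 0
  have hY : thetaConst 0 (4 / 3) σ = thetaConst 0 (2 / 3) σ := by
    have := thetaConst_add_two_right 0 (-(2 / 3)) σ
    rw [show (-(2 / 3) + 2 : ℝ) = 4 / 3 by norm_num, ← thetaConst_neg_neg 0 (-(2 / 3)), neg_neg,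
      neg_zero] at this
    simpa using this
  have hY' : thetaConst 1 (4 / 3) σ = -thetaConst 1 (2 / 3) σ := by
    -- The characteristic `-1` is equivalent to `1` modulo 2; the sign is `e^{-πi}`.
    have := thetaConst_add_two_right (-1) (-(2 / 3)) σ
    rw [thetaConst_neg_neg, ← thetaConst_add_two_left] at this
    norm_num at this
    simpa [Complex.exp_neg] using this
  have hS (b : ℝ) : thetaConst (1 + 1) b σ = thetaConst 0 b σ := by
    rw [← thetaConst_add_two_left 0]
    norm_num
  rw [hS, zero_add] at h
  simp only [zero_add, mul_zero, ofReal_zero, Complex.exp_zero, one_mul] at h01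
  rw [mul_assoc, mul_comm (thetaConst 1 0 τ), h, h01]
  simp only [thetaConst_sq hσ, hS, zero_add]
  norm_num only [] at *
  rw [hY, hY']
  ring

theorem mainTheorem10 (τ : UpperHalfPlane) :
    (thetaConst (1 / 3) (1 / 3) τ ^ 2 * thetaConst (1 / 3) (4 / 3) τ ^ 2
        + zetaRoot 3 ^ 2 * thetaConst (2 / 3) (2 / 3) τ ^ 2 * thetaConst (2 / 3) (5 / 3) τ ^ 2
        - thetaConst 0 0 τ ^ 2 * thetaConst 0 1 τ * thetaConst (2 / 3) (5 / 3) τ = 0) ∧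
    (thetaConst (1 / 3) 0 τ ^ 2 * thetaConst (1 / 3) 1 τ ^ 2
        + zetaRoot 3 * thetaConst (2 / 3) 0 τ ^ 2 * thetaConst (2 / 3) 1 τ ^ 2
        - thetaConst 0 0 τ ^ 2 * thetaConst 0 1 τ * thetaConst (2 / 3) 1 τ = 0) ∧
    (thetaConst (1 / 3) (2 / 3) τ ^ 2 * thetaConst (1 / 3) (5 / 3) τ ^ 2
        + zetaRoot 3 ^ 2 * thetaConst (2 / 3) (1 / 3) τ ^ 2 * thetaConst (2 / 3) (4 / 3) τ ^ 2
        - zetaRoot 3 * thetaConst 0 0 τ ^ 2 * thetaConst 0 1 τ * thetaConst (2 / 3) (1 / 3) τ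
          = 0) ∧
    (thetaConst 1 (1 / 3) τ ^ 2 * thetaConst 0 (2 / 3) τ ^ 2
        - thetaConst 0 (1 / 3) τ ^ 2 * thetaConst 1 (2 / 3) τ ^ 2
        - thetaConst 0 1 τ ^ 2 * thetaConst 1 0 τ * thetaConst 1 (2 / 3) τ = 0) := by
  have key (b : ℝ) := thetaConst_duplication (1 / 3) b τ
  simp only [show (1 / 3 + 1 : ℝ) = 4 / 3 by norm_num, thetaConst_four_thirds_sq,
    show (2 * (1 / 3) : ℝ) = 2 / 3 by norm_num] at key
  refine ⟨?_, ?_, ?_, sub_eq_zero.2 (thetaConst_one_sq_mul_sub τ)⟩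
  · have h := key (1 / 3)
    norm_num only [] at h ⊢
    linear_combination h
  · have h := key 0
    -- Reducing `ε' = 2` to `0` gives a further `ζ₃²` after squaring, and `ζ₃⁴ = ζ₃`.
    have h₂ := thetaConst_add_two_right (2 / 3) 0 τ
    rw [exp_pi_mul_I_mul_two_thirds] at h₂
    norm_num only [] at h h₂ ⊢
    rw [h₂] at h
    linear_combination h - zetaRoot 3 * thetaConst (2 / 3) 0 τ ^ 2 * thetaConst (2 / 3) 1 τ ^ 2 *
      zetaRoot_three_pow_three
  · have h := key (2 / 3)
    -- The right side of `h` carries `ε' = 7/3`; reducing it to `1/3` produces the `ζ₃` in (3).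
    have h₂ := thetaConst_add_two_right (2 / 3) (1 / 3) τ
    rw [exp_pi_mul_I_mul_two_thirds] at h₂
    norm_num only [] at h h₂ ⊢
    rw [h₂] at h
    linear_combination h
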